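/- **Maps.** A map $\mathcal M$ is a 2-cell embedding of a connected graph on a surface (without boundary), described by its flag graph: a nonempty set $\mathcal F(\mathcal M)$ of flags (the triangles of the barycentric subdivision), with fixed-point free involutions $s_0,s_1,s_2$, where $\Phi^{i}=\Phi^{s_i}$ is the flag $i$-adjacent to $\Phi$, such that $s_0s_2=s_2s_0$ is fixed-point free and the graph with edges $\{\Phi,\Phi^i\}$ is connected. An automorphism of $\mathcal M$ is a permutation of $\mathcal F(\mathcal M)$ commuting with $s_0,s_1,s_2$, and $\mathcal M$ is a $k$-orbit map if the automorphism group has exactly $k$ orbits on flags. The symmetry type graph $T(\mathcal M)$ has the flag-orbits as vertices, and two orbits (possibly equal, which gives a semi-edge) are joined by an edge of colour $i$ if they contain $i$-adjacent flags. $\mathcal M$ is of type $T$ if $T(\mathcal M)$ is isomorphic to $T$ as an edge-coloured graph. **Truncation.** $\mathrm{Tr}(\mathcal M)$ is the map with flag set $\mathcal F(\mathcal M)\times\{0,1,2\}$ and adjacencies $r_0,r_1,r_2$ given by $$\begin{aligned} (\Phi,0)r_0&=(\Phi^{1},0),&(\Phi,0)r_1&=(\Phi^{2},0),&(\Phi,0)r_2&=(\Phi,2),\\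 (\Phi,1)r_0&=(\Phi^{0},1),&(\Phi,1)r_1&=(\Phi,2),&(\Phi,1)r_2&=(\Phi^{2},1),\\ (\Phi,2)r_0&=(\Phi^{1},2),&(\Phi,2)r_1&=(\Phi,1),&(\Phi,2)r_2&=(\Phi,0). \end{aligned}$$ The same rule, applied to vertices, defines the truncation $\mathrm{Tr}(T)$ of a symmetry type graph $T$. **Types.** For a symmetry type graph $T$, the dual $T_d$ exchanges the colours $i$ and $2-i$, the Petrie-dual $T_p$ replaces the edges of colour $0$ by the walks with colours $0,2$; $T_{dp}=(T_d)_p$ and $T_{opp}=((T_p)_d)_p$. For $I\subsetneq\{0,1,2\}$ let $2_I$ be the graph with two vertices, semi-edges of the colours in $I$ at both vertices, and an edge of each other colour between the two vertices ($2=2_\emptyset$). Up to isomorphism put $$6_B=\mathrm{Tr}(2_{01}),\quad 6_G=\mathrm{Tr}(2_0),\quad 6_H=\mathrm{Tr}(2_{02}),$$ $$6_{M_d}=\mathrm{Tr}(2_2),\quad 6_{N_d}=\mathrm{Tr}(2),\quad 6_{O_d}=\mathrm{Tr}(2_1),\quad 6_{P_d}=\mathrm{Tr}(2_{12}),$$ and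 let $6_M,6_N,6_O,6_P$ be the duals of the last four. On the vertices $0,\dots,5$, with semi-edges wherever no edge is named, let $6_{F_d}$ have edges $01,23,45$ of colour $0$, $12,35$ of colour $1$, and $24,35$ of colour $2$; let $6_{J_d}$ have edges $23,45$ of colour $0$, $12,34$ of colour $1$, and $01,45$ of colour $2$; and let $6_J$ be the dual of $6_{J_d}$. **Proposition.** If $\mathcal M$ is a 6-orbit map and its truncation $\mathrm{Tr}(\mathcal M)$ is a 6-orbit map, then one of the following holds. 1. $\mathcal M$ and $\mathrm{Tr}(\mathcal M)$ are of type $6_{B_p}$. 2. $\mathcal M$ and $\mathrm{Tr}(\mathcal M)$ are of type $6_{G_p}$. 3. $\mathcal M$ and $\mathrm{Tr}(\mathcal M)$ are of type $6_{H_p}$. 4. $\mathcal M$ is of type $6_{J_p}$ and $\mathrm{Tr}(\mathcal M)$ is of type $6_{J_d}$. 5. $\mathcal M$ is of type $6_{M_{opp}}$ and $\mathrm{Tr}(\mathcal M)$ is of type $6_{N_{dp}}$. 6. $\mathcal M$ is of type $6_{N_{opp}}$ and $\mathrm{Tr}(\mathcal M)$ is of type $6_{F_d}$ or of type $6_{M_{dp}}$.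 7. $\mathcal M$ is of type $6_{O_{opp}}$ and $\mathrm{Tr}(\mathcal M)$ is of type $6_{P_{dp}}$. 8. $\mathcal M$ is of type $6_{P_{opp}}$ and $\mathrm{Tr}(\mathcal M)$ is of type $6_{O_{dp}}$. -/

import Mathlib

universe u v w

/-- A map, i.e. a 2-cell embedding of a connected graph on a surface, given by its flag graph:
the set of flags (triangles of the barycentric subdivision) together with the functions
`Φ ↦ Φ^i`, `i = 0, 1, 2`, sending a flag to its `i`-adjacent flag. The three functions and the
product of those of colours 0 and 2 are fixed-point free involutions, the colours 0 and 2 commute,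
and the flag graph is connected. -/
structure SurfaceMap where
  /-- The set of flags. -/
  Flag : Type u
  /-- `adj i Φ` is the flag `i`-adjacent to `Φ`. -/
  adj : Fin 3 → Flag → Flag
  nonempty : Nonempty Flag
  adj_adj : ∀ i Φ, adj i (adj i Φ) = Φ
  adj_ne : ∀ i Φ, adj i Φ ≠ Φ
  adj_zero_two : ∀ Φ, adj 0 (adj 2 Φ) = adj 2 (adj 0 Φ)
  adj_zero_two_ne : ∀ Φ, adj 0 (adj 2 Φ) ≠ Φ
  connected : ∀ Φ Ψ, Relation.ReflTransGen (fun a b => ∃ i, adj i a = b) Φ Ψ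

/-- The truncation rule: every `x` is replaced by `(x, 0)`, `(x, 1)`, `(x, 2)`, and the new
adjacencies `r₀, r₁, r₂` are obtained from the adjacencies `s 0`, `s 1`, `s 2`. It is applied both
to flags of maps and to vertices of symmetry type graphs. -/
def truncAdj {V : Type v} (s : Fin 3 → V → V) : Fin 3 → V × Fin 3 → V × Fin 3
  | 0, (x, 0) => (s 1 x, 0)
  | 1, (x, 0) => (s 2 x, 0)
  | 2, (x, 0) => (x, 2)
  | 0, (x, 1) => (s 0 x, 1)
  | 1, (x, 1) => (x, 2)
  | 2, (x, 1) => (s 2 x, 1)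
  | 0, (x, 2) => (s 1 x, 2)
  | 1, (x, 2) => (x, 1)
  | 2, (x, 2) => (x, 0)

namespace SurfaceMap

theorem trunc_connected (M : SurfaceMap.{u}) (a b : M.Flag × Fin 3) :
    Relation.ReflTransGen (fun a b => ∃ i, truncAdj M.adj i a = b) a b := by
  have t02 : ∀ x, Relation.ReflTransGen (fun a b => ∃ i, truncAdj M.adj i a = b)
      (x, 0) (x, 2) := fun x => .single ⟨2, rfl⟩
  have t20 : ∀ x, Relation.ReflTransGen (fun a b => ∃ i, truncAdj M.adj i a = b)
      (x, 2) (x, 0) := fun x => .single ⟨2, rfl⟩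
  have t12 : ∀ x, Relation.ReflTransGen (fun a b => ∃ i, truncAdj M.adj i a = b)
      (x, 1) (x, 2) := fun x => .single ⟨1, rfl⟩
  have t21 : ∀ x, Relation.ReflTransGen (fun a b => ∃ i, truncAdj M.adj i a = b)
      (x, 2) (x, 1) := fun x => .single ⟨1, rfl⟩
  have s : ∀ x i, Relation.ReflTransGen (fun a b => ∃ i, truncAdj M.adj i a = b)
      (x, 0) (M.adj i x, 0) := by
    intro x i
    fin_cases i
    · exact (((t02 x).trans (t21 x)).trans (.single ⟨0, rfl⟩)).trans ((t12 _).trans (t20 _))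
    · exact .single ⟨0, rfl⟩
    · exact .single ⟨1, rfl⟩
  have c : ∀ x y, Relation.ReflTransGen (fun a b => ∃ i, truncAdj M.adj i a = b)
      (x, 0) (y, 0) := by
    intro x y
    induction M.connected x y with
    | refl => exact .refl
    | tail _ h ih =>
      obtain ⟨i, rfl⟩ := h
      exact ih.trans (s _ i)
  obtain ⟨x, i⟩ := a
  obtain ⟨y, j⟩ := b
  have h1 : Relation.ReflTransGen (fun a b => ∃ i, truncAdj M.adj i a = b) (x, i) (x, 0) := by
    fin_cases i
    · exact .refl
    · exact (t12 x).trans (t20 x)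
    · exact t20 x
  have h2 : Relation.ReflTransGen (fun a b => ∃ i, truncAdj M.adj i a = b) (y, 0) (y, j) := by
    fin_cases j
    · exact .refl
    · exact (t02 y).trans (t21 y)
    · exact t02 y
  exact (h1.trans (c x y)).trans h2

/-- The truncation `Tr(M)`. -/
def truncation (M : SurfaceMap.{u}) : SurfaceMap.{u} where
  Flag := M.Flag × Fin 3
  adj := truncAdj M.adj
  nonempty := M.nonempty.map fun Φ => (Φ, 0)
  adj_adj := by
    rintro i ⟨Φ, j⟩
    fin_cases i <;> fin_cases j <;> simp [truncAdj, M.adj_adj]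
  adj_ne := by
    rintro i ⟨Φ, j⟩
    fin_cases i <;> fin_cases j <;> simp [truncAdj, M.adj_ne]
  adj_zero_two := by
    rintro ⟨Φ, j⟩
    fin_cases j <;> simp [truncAdj, M.adj_zero_two]
  adj_zero_two_ne := by
    rintro ⟨Φ, j⟩
    fin_cases j <;> simp [truncAdj, M.adj_zero_two_ne]
  connected := M.trunc_connected

/-- The automorphism group `Γ(M)`: the colour preserving automorphisms of the flag graph. -/
def autGroup (M : SurfaceMap.{u}) : Subgroup (Equiv.Perm M.Flag) where
  carrier := {γ | ∀ i Φ, γ (M.adj i Φ) = M.adj i (γ Φ)}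
  mul_mem' := fun {a b} ha hb i Φ => by
    rw [Equiv.Perm.mul_apply, Equiv.Perm.mul_apply, hb i Φ, ha i (b Φ)]
  one_mem' := fun _ _ => rfl
  inv_mem' := fun {a} ha i Φ => by
    apply a.injective
    rw [ha i]
    simp

/-- The set `Orb(M)` of orbits of flags under the automorphism group. -/
abbrev Orb (M : SurfaceMap.{u}) : Type u :=
  MulAction.orbitRel.Quotient M.autGroup M.Flag

/-- `M` is a `k`-orbit map. -/
def IsOrbitMap (k : ℕ) (M : SurfaceMap.{u}) : Prop :=
  Finite M.Orb ∧ Nat.card M.Orb = k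

end SurfaceMap

/-- A graph with edges coloured 0, 1, 2 on the vertex set `V`. An edge of colour `i` from a vertex
to itself is a semi-edge; edges of different colours may be parallel. -/
structure ColouredGraph (V : Type v) where
  /-- `Adj i a b`: there is an edge of colour `i` between `a` and `b`. -/
  Adj : Fin 3 → V → V → Prop

namespace ColouredGraph

/-- Isomorphism of coloured graphs, preserving the colours. -/
def Isomorphic {V : Type v} {W : Type w} (G : ColouredGraph V) (H : ColouredGraph W) : Prop :=
  ∃ e : V ≃ W, ∀ i a b, G.Adj i a b ↔ H.Adj i (e a) (e b)

/-- The coloured graph in which `s i a` is the neighbour of `a` along colour `i`. -/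
def ofFun {V : Type v} (s : Fin 3 → V → V) : ColouredGraph V where
  Adj i a b := s i a = b

/-- The dual `T_d`: the colours `i` and `2 - i` are exchanged. -/
def dual {V : Type v} (G : ColouredGraph V) : ColouredGraph V where
  Adj i := G.Adj (Fin.rev i)

/-- The Petrie-dual `T_p`: the edges of colour 0 are replaced by the walks with colours 0, 2. -/
def petrie {V : Type v} (G : ColouredGraph V) : ColouredGraph V where
  Adj
  | 0 => fun a b => ∃ c, G.Adj 0 a c ∧ G.Adj 2 c b
  | 1 => G.Adj 1
  | 2 => G.Adj 2

/-- The opposite `T_opp`, the Petrie-dual of the dual of the Petrie-dual. -/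
def opposite {V : Type v} (G : ColouredGraph V) : ColouredGraph V :=
  G.petrie.dual.petrie

end ColouredGraph

namespace SurfaceMap

/-- The symmetry type graph `T(M)`: its vertices are the flag-orbits, two of which are joined by an
edge of colour `i` when they contain `i`-adjacent flags. -/
def symTypeGraph (M : SurfaceMap.{u}) : ColouredGraph M.Orb where
  Adj i O P := ∃ Φ Ψ : M.Flag, (Quotient.mk _ Φ : M.Orb) = O ∧ (Quotient.mk _ Ψ : M.Orb) = P ∧
    M.adj i Φ = Ψ

/-- `M` is of type `T`. -/
def HasType {V : Type v} (M : SurfaceMap.{u}) (T : ColouredGraph V) : Prop :=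
  M.symTypeGraph.Isomorphic T

end SurfaceMap

namespace SymType

open ColouredGraph

/-- The two-vertex type `2_I`: semi-edges of the colours in `I` at both vertices, and edges of the
other colours between the two vertices. -/
def two (I : Finset (Fin 3)) (i : Fin 3) (x : Fin 2) : Fin 2 :=
  if i ∈ I then x else Fin.rev x

/-- `6_B`, the truncated symmetry type graph of `2_01`. -/
def sixB : ColouredGraph (Fin 2 × Fin 3) := ofFun (truncAdj (two {0, 1}))

/-- `6_G`, the truncated symmetry type graph of `2_0`. -/
def sixG : ColouredGraph (Fin 2 × Fin 3) := ofFun (truncAdj (two {0}))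

/-- `6_H`, the truncated symmetry type graph of `2_02`. -/
def sixH : ColouredGraph (Fin 2 × Fin 3) := ofFun (truncAdj (two {0, 2}))

/-- `6_M`; its dual `6_{M_d}` is the truncated symmetry type graph of `2_2`. -/
def sixM : ColouredGraph (Fin 2 × Fin 3) := (ofFun (truncAdj (two {2}))).dual

/-- `6_N`; its dual `6_{N_d}` is the truncated symmetry type graph of the chiral type `2`. -/
def sixN : ColouredGraph (Fin 2 × Fin 3) := (ofFun (truncAdj (two ∅))).dual

/-- `6_O`; its dual `6_{O_d}` is the truncated symmetry type graph of `2_1`. -/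
def sixO : ColouredGraph (Fin 2 × Fin 3) := (ofFun (truncAdj (two {1}))).dual

/-- `6_P`; its dual `6_{P_d}` is the truncated symmetry type graph of `2_12`. -/
def sixP : ColouredGraph (Fin 2 × Fin 3) := (ofFun (truncAdj (two {1, 2}))).dual

/-- `6_{F_d}`: edges `01, 23, 45` of colour 0, edges `12, 35` of colour 1, edges `24, 35` of
colour 2, and semi-edges elsewhere. One face-orbit and three vertex-orbits, with 1, 2, 3
flag-orbits. -/
def sixFd : ColouredGraph (Fin 6) :=
  ofFun ![![1, 0, 3, 2, 5, 4], ![0, 2, 1, 5, 4, 3], ![0, 1, 4, 5, 2, 3]]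

/-- `6_{J_d}`: edges `23, 45` of colour 0, edges `12, 34` of colour 1, edges `01, 45` of
colour 2, and semi-edges elsewhere. Two face-orbits, with 1 and 5 flag-orbits. -/
def sixJd : ColouredGraph (Fin 6) :=
  ofFun ![![0, 1, 3, 2, 5, 4], ![0, 2, 1, 4, 3, 5], ![1, 0, 2, 3, 5, 4]]

def sixBp := sixB.petrie

def sixGp := sixG.petrie

def sixHp := sixH.petrie

/-- `6_{J_p}`, the Petrie-dual of `6_J`, where `6_J` is the dual of `6_{J_d}`. -/
def sixJp := sixJd.dual.petrie

def sixMdp := sixM.dual.petrie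

def sixNdp := sixN.dual.petrie

def sixOdp := sixO.dual.petrie

def sixPdp := sixP.dual.petrie

def sixMopp := sixM.opposite

def sixNopp := sixN.opposite

def sixOopp := sixO.opposite

def sixPopp := sixP.opposite

end SymType

/-!
The symmetry type graph of the truncation determines that of the map. Along the words `r₂r₁r₀r₁r₂`,
`r₀`, `r₁` of adjacencies of `Tr(M)`, a flag `(Φ, 0)` moves to `(Φ⁰, 0)`, `(Φ¹, 0)`, `(Φ², 0)`; so
an automorphism of `Tr(M)` taking one flag `(Φ, 0)` to a flag `(Ψ, 0)` permutes all flags of this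
form and restricts to an automorphism of `M`. Hence the map from the flag-orbits of `M` to those of
`Tr(M)` induced by `Φ ↦ (Φ, 0)` is injective (`SurfaceMap.orbToTruncation_injective`). When both
maps have six flag-orbits it is bijective, and `T(M)` is the graph `untruncAdj r` on the vertices of
`T(Tr(M))`, where `r` denotes the adjacencies of `T(Tr(M))` (`SurfaceMap.funIso_untruncAdj`).

The adjacencies `r₀, r₁, r₂` of `T(Tr(M))` are involutions (possibly with fixed points) satisfying
`r₀r₂ = r₂r₀` and, as the vertices of a truncation have degree three, `r₁r₂r₁ = r₂r₁r₂`. Moreover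
`untruncAdj r` is connected, because `T(M)` is. On six points this leaves exactly nine graphs up to
isomorphism (`SymType.isTruncationType_of_card`), and applying `untruncAdj` to each of them gives
the type of `M` (`SymType.funIso_untruncAdj_six`). The nine graphs are found by a finite search:
`r₂` may be taken to be one of four representatives of the possible cycle types, which leaves 640
triples, and isomorphisms are detected by numbering the vertices in the order of a depth-first
search from a root.
-/

/-! ### Coloured graphs given by neighbour functions -/

namespace ColouredGraph

/-- The neighbour functions of the dual of `ofFun s`. -/
def dualFun {V : Type v} (s : Fin 3 → V → V) : Fin 3 → V → V
  | 0 => s 2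
  | 1 => s 1
  | 2 => s 0

/-- The neighbour functions of the Petrie-dual of `ofFun s`. -/
def petrieFun {V : Type v} (s : Fin 3 → V → V) : Fin 3 → V → V
  | 0 => fun a => s 2 (s 0 a)
  | 1 => s 1
  | 2 => s 2

theorem dual_ofFun {V : Type v} (s : Fin 3 → V → V) : (ofFun s).dual = ofFun (dualFun s) := by
  unfold dual ofFun
  congr 1
  funext i
  fin_cases i <;> rfl

theorem petrie_ofFun {V : Type v} (s : Fin 3 → V → V) :
    (ofFun s).petrie = ofFun (petrieFun s) := by
  unfold petrie ofFun
  congr 1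
  funext i a b
  fin_cases i
  · simp [petrieFun]
  · rfl
  · rfl

/-- An isomorphism of coloured graphs given by neighbour functions. -/
def FunIso {V : Type v} {W : Type w} (r : Fin 3 → V → V) (t : Fin 3 → W → W) : Prop :=
  ∃ e : V ≃ W, ∀ i a, e (r i a) = t i (e a)

namespace FunIso

variable {V : Type v} {W : Type w} {U : Type u}

theorem trans {r : Fin 3 → V → V} {t : Fin 3 → W → W} {q : Fin 3 → U → U}
    (h : FunIso r t) (h' : FunIso t q) : FunIso r q := by
  obtain ⟨e, he⟩ := h
  obtain ⟨f, hf⟩ := h'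
  exact ⟨e.trans f, fun i a => by simp [he, hf]⟩

theorem isomorphic {r : Fin 3 → V → V} {t : Fin 3 → W → W} (h : FunIso r t) :
    (ofFun r).Isomorphic (ofFun t) := by
  obtain ⟨e, he⟩ := h
  refine ⟨e, fun i a b => ?_⟩
  change r i a = b ↔ t i (e a) = e b
  rw [← he, e.apply_eq_iff_eq]

end FunIso

end ColouredGraph

/-! ### Recovering a map from its truncation -/

/-- The adjacencies of a map expressed by the adjacencies `r` of its truncation: moving a flag
`(Φ, 0)` along the words `r₂r₁r₀r₁r₂`, `r₀`, `r₁` leads to `(Φ⁰, 0)`, `(Φ¹, 0)`, `(Φ², 0)`. -/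
def untruncAdj {V : Type v} (r : Fin 3 → V → V) : Fin 3 → V → V
  | 0 => fun x => r 2 (r 1 (r 0 (r 1 (r 2 x))))
  | 1 => r 0
  | 2 => r 1

theorem untruncAdj_truncAdj {V : Type v} (s : Fin 3 → V → V) (i : Fin 3) (x : V) :
    untruncAdj (truncAdj s) i (x, 0) = (s i x, 0) := by
  fin_cases i <;> rfl

/-- A map intertwining `r` and `t` intertwines the words of `untruncAdj`. -/
theorem untruncAdj_comm {V : Type v} {W : Type w} {r : Fin 3 → V → V} {t : Fin 3 → W → W}
    {e : V → W} (h : ∀ i a, e (r i a) = t i (e a)) (i : Fin 3) (a : V) :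
    e (untruncAdj r i a) = untruncAdj t i (e a) := by
  fin_cases i <;> simp [untruncAdj, h]

theorem ColouredGraph.FunIso.untruncAdj {V : Type v} {W : Type w} {r : Fin 3 → V → V}
    {t : Fin 3 → W → W} (h : FunIso r t) : FunIso (untruncAdj r) (untruncAdj t) :=
  h.imp fun _ he => untruncAdj_comm he

/-! ### Flag-orbits of a map and of its truncation -/

namespace SurfaceMap

theorem autGroup_smul_adj (M : SurfaceMap.{u}) (γ : M.autGroup) (i : Fin 3) (Φ : M.Flag) :
    γ • M.adj i Φ = M.adj i (γ • Φ) :=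
  γ.2 i Φ

/-- The flag-orbit `i`-adjacent to a flag-orbit. -/
def orbAdj (M : SurfaceMap.{u}) (i : Fin 3) : M.Orb → M.Orb :=
  Quotient.map (M.adj i) fun _ Ψ ⟨γ, hγ⟩ =>
    ⟨γ, (M.autGroup_smul_adj γ i Ψ).trans (congrArg (M.adj i) hγ)⟩

theorem symTypeGraph_eq_ofFun (M : SurfaceMap.{u}) :
    M.symTypeGraph = ColouredGraph.ofFun M.orbAdj := by
  unfold symTypeGraph ColouredGraph.ofFun
  congr 1
  funext i O P
  induction O using Quotient.inductionOn with | _ Φ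
  refine propext ⟨?_, fun h => ⟨Φ, M.adj i Φ, rfl, h, rfl⟩⟩
  rintro ⟨Φ', Ψ, h, rfl, rfl⟩
  rw [← h]
  rfl

theorem hasType_of_funIso {V : Type v} {M : SurfaceMap.{u}} {t : Fin 3 → V → V}
    (h : ColouredGraph.FunIso M.orbAdj t) : M.HasType (ColouredGraph.ofFun t) := by
  rw [HasType, symTypeGraph_eq_ofFun]
  exact h.isomorphic

theorem orbAdj_orbAdj (M : SurfaceMap.{u}) (i : Fin 3) (O : M.Orb) :
    M.orbAdj i (M.orbAdj i O) = O := by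
  induction O using Quotient.inductionOn with | _ Φ
  exact congrArg (Quotient.mk _) (M.adj_adj i Φ)

theorem orbAdj_zero_two (M : SurfaceMap.{u}) (O : M.Orb) :
    M.orbAdj 0 (M.orbAdj 2 O) = M.orbAdj 2 (M.orbAdj 0 O) := by
  induction O using Quotient.inductionOn with | _ Φ
  exact congrArg (Quotient.mk _) (M.adj_zero_two Φ)

/-- The vertices of a truncation have degree three. -/
theorem truncation_orbAdj_braid (M : SurfaceMap.{u}) (O : M.truncation.Orb) :
    M.truncation.orbAdj 1 (M.truncation.orbAdj 2 (M.truncation.orbAdj 1 O)) =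
      M.truncation.orbAdj 2 (M.truncation.orbAdj 1 (M.truncation.orbAdj 2 O)) := by
  induction O using Quotient.inductionOn with | _ Φ
  obtain ⟨Φ, j⟩ := Φ
  refine congrArg (Quotient.mk _) ?_
  fin_cases j <;> rfl

theorem orb_induction (M : SurfaceMap.{u}) {p : M.Orb → Prop}
    (h : ∀ i O, p O → p (M.orbAdj i O)) {O : M.Orb} (hO : p O) (P : M.Orb) : p P := by
  induction O using Quotient.inductionOn with | _ Φ
  induction P using Quotient.inductionOn with | _ Ψ
  induction M.connected Φ Ψ with
  | refl => exact hO
  | tail _ hi ih =>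
    obtain ⟨i, rfl⟩ := hi
    exact h i _ ih

/-- An automorphism of the truncation that moves one flag `(Φ, 0)` to a flag `(Ψ, 0)` does so with
all of them. -/
theorem truncation_smul_snd (M : SurfaceMap.{u}) (g : M.truncation.autGroup) {Φ Ψ : M.Flag}
    (h : g.1 (Φ, 0) = (Ψ, 0)) (X : M.Flag) : (g.1 (X, 0)).2 = 0 := by
  induction M.connected Φ X with
  | refl => rw [h]
  | @tail Y _ _ hi ih =>
    obtain ⟨i, rfl⟩ := hi
    have hY : g.1 (Y, 0) = ((g.1 (Y, 0)).1, 0) := Prod.ext rfl ih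
    have := untruncAdj_comm (e := g.1) (r := truncAdj M.adj) (t := truncAdj M.adj) g.2 i (Y, 0)
    rw [untruncAdj_truncAdj, hY, untruncAdj_truncAdj] at this
    rw [this]

theorem truncation_smul_adj (M : SurfaceMap.{u}) (g : M.truncation.autGroup) {Φ Ψ : M.Flag}
    (h : g.1 (Φ, 0) = (Ψ, 0)) (i : Fin 3) (X : M.Flag) :
    (g.1 (M.adj i X, 0)).1 = M.adj i (g.1 (X, 0)).1 := by
  have hX : g.1 (X, 0) = ((g.1 (X, 0)).1, 0) := Prod.ext rfl (M.truncation_smul_snd g h X)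
  have := untruncAdj_comm (e := g.1) (r := truncAdj M.adj) (t := truncAdj M.adj) g.2 i (X, 0)
  rw [untruncAdj_truncAdj, hX, untruncAdj_truncAdj] at this
  rw [this]

/-- Two flags `(Φ, 0)` and `(Ψ, 0)` in the same orbit of the truncation come from flags `Φ` and `Ψ`
in the same orbit of the map: an automorphism of the truncation mapping one to the other permutes
the flags of the form `(X, 0)`, hence restricts to an automorphism of the map. -/
theorem exists_smul_eq_of_truncation (M : SurfaceMap.{u}) (g : M.truncation.autGroup)
    {Φ Ψ : M.Flag} (h : g.1 (Φ, 0) = (Ψ, 0)) : ∃ γ : M.autGroup, γ.1 Φ = Ψ := by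
  have h' : (g⁻¹).1 (Ψ, 0) = (Φ, 0) := by
    rw [← h]
    exact g.1.symm_apply_apply _
  refine ⟨⟨⟨fun X => (g.1 (X, 0)).1, fun X => ((g⁻¹).1 (X, 0)).1, fun X => ?_, fun X => ?_⟩,
    M.truncation_smul_adj g h⟩, congrArg Prod.fst h⟩
  · have hX : ((g.1 (X, 0)).1, 0) = g.1 (X, 0) :=
      Prod.ext rfl (M.truncation_smul_snd g h X).symm
    change ((g⁻¹).1 ((g.1 (X, 0)).1, 0)).1 = X
    rw [hX]
    exact congrArg Prod.fst (g.1.symm_apply_apply (X, 0))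
  · have hX : (((g⁻¹).1 (X, 0)).1, 0) = (g⁻¹).1 (X, 0) :=
      Prod.ext rfl (M.truncation_smul_snd g⁻¹ h' X).symm
    change (g.1 (((g⁻¹).1 (X, 0)).1, 0)).1 = X
    rw [hX]
    exact congrArg Prod.fst (g.1.apply_symm_apply (X, 0))

/-- The orbit of `Φ` is sent to the orbit of `(Φ, 0)`. -/
def orbToTruncation (M : SurfaceMap.{u}) : M.Orb → M.truncation.Orb :=
  Quotient.map (fun Φ => (Φ, 0)) fun Φ Ψ ⟨γ, hγ⟩ => by
    refine ⟨⟨Equiv.prodCongr γ.1 (Equiv.refl _), ?_⟩, Prod.ext hγ rfl⟩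
    rintro i ⟨X, j⟩
    fin_cases i <;> fin_cases j <;> first | rfl | exact congrArg (·, _) (γ.2 _ X)

theorem orbToTruncation_injective (M : SurfaceMap.{u}) :
    Function.Injective M.orbToTruncation := by
  intro O P h
  induction O using Quotient.inductionOn with | _ Φ
  induction P using Quotient.inductionOn with | _ Ψ
  obtain ⟨g, hg⟩ := Quotient.exact h
  obtain ⟨γ, hγ⟩ := M.exists_smul_eq_of_truncation g hg
  exact Quotient.sound ⟨γ, hγ⟩

theorem orbToTruncation_orbAdj (M : SurfaceMap.{u}) (i : Fin 3) (O : M.Orb) :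
    M.orbToTruncation (M.orbAdj i O) =
      untruncAdj M.truncation.orbAdj i (M.orbToTruncation O) := by
  induction O using Quotient.inductionOn with | _ Φ
  fin_cases i <;> rfl

/-- If a map and its truncation have the same finite number of flag-orbits, then the symmetry type
graph of the truncation determines that of the map. -/
theorem funIso_untruncAdj (M : SurfaceMap.{u}) {k : ℕ} (hM : M.IsOrbitMap k)
    (hTr : M.truncation.IsOrbitMap k) :
    ColouredGraph.FunIso M.orbAdj (untruncAdj M.truncation.orbAdj) := by
  have := hM.1
  have := hTr.1
  have hb : Function.Bijective M.orbToTruncation :=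
    (Nat.bijective_iff_injective_and_card _).2
      ⟨M.orbToTruncation_injective, hM.2.trans hTr.2.symm⟩
  exact ⟨Equiv.ofBijective _ hb, M.orbToTruncation_orbAdj⟩

end SurfaceMap

/-! ### Detecting isomorphisms -/

namespace ColouredGraph

section RootedCode

variable {V : Type v} {W : Type w} [DecidableEq V] [DecidableEq W]

/-- Depth-first search from `x`: the vertices that are reached from `x` without passing through `l`
are put in front of `l`, the last one found first. The number `n` bounds the depth. -/
def visit (r : Fin 3 → V → V) : ℕ → List V → V → List V
  | 0, l, _ => l
  | n + 1, l, x => if x ∈ l then l else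
      visit r n (visit r n (visit r n (x :: l) (r 0 x)) (r 1 x)) (r 2 x)

theorem visit_nodup (r : Fin 3 → V → V) (n : ℕ) {l : List V} (hl : l.Nodup) (x : V) :
    (visit r n l x).Nodup := by
  induction n generalizing l x with
  | zero => exact hl
  | succ n ih =>
    rw [visit]
    split_ifs with h
    · exact hl
    · exact ih (ih (ih (List.nodup_cons.2 ⟨h, hl⟩) _) _) _

theorem mem_visit (r : Fin 3 → V → V) (n : ℕ) {l : List V} (x : V) {y : V} (hy : y ∈ l) :
    y ∈ visit r n l x := by
  induction n generalizing l x with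
  | zero => exact hy
  | succ n ih =>
    rw [visit]
    split_ifs
    · exact hy
    · exact ih _ (ih _ (ih _ (List.mem_cons_of_mem x hy)))

/-- The vertices of a graph with at most six vertices that depth-first search from the root `x`
finds, the last one first. A search path has no repeated vertices, so depth six suffices. -/
def order (r : Fin 3 → V → V) (x : V) : List V := visit r 6 [] x

theorem order_nodup (r : Fin 3 → V → V) (x : V) : (order r x).Nodup :=
  visit_nodup r 6 List.nodup_nil x

theorem mem_order_self (r : Fin 3 → V → V) (x : V) : x ∈ order r x := by
  rw [order, visit, if_neg List.not_mem_nil]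
  exact mem_visit r _ _ (mem_visit r _ _ (mem_visit r _ _ List.mem_cons_self))

/-- The table of the neighbour functions, the vertices being numbered by `order r x`. -/
def rootedCode (r : Fin 3 → V → V) (x : V) : List (List ℕ) :=
  (order r x).map fun v => (List.finRange 3).map fun i => (order r x).idxOf (r i v)

theorem mem_order [Fintype V] {r : Fin 3 → V → V} {x : V}
    (h : (order r x).length = Fintype.card V) (v : V) : v ∈ order r x := by
  have := (Finset.card_eq_iff_eq_univ (order r x).toFinset).1
    (by rw [List.toFinset_card_of_nodup (order_nodup r x), h])
  exact List.mem_toFinset.1 (this ▸ Finset.mem_univ v)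

/-- A graph all of whose vertices are found from its root is determined by its rooted code. Only
`t` has to be checked for this, as equal codes have equal length. -/
theorem funIso_of_rootedCode_eq [Fintype V] [Fintype W] {r : Fin 3 → V → V} {t : Fin 3 → W → W}
    {x : V} {y : W} (hc : Fintype.card V = Fintype.card W)
    (hy : (order t y).length = Fintype.card W) (h : rootedCode r x = rootedCode t y) :
    FunIso r t := by
  have hlen : (order r x).length = (order t y).length := by
    simpa [rootedCode] using congrArg List.length h
  let e := (order_nodup r x).getEquivOfForallMemList _ (mem_order (by rw [hlen, hy, hc]))
  let f := (order_nodup t y).getEquivOfForallMemList _ (mem_order hy)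
  refine ⟨(e.symm.trans (finCongr hlen)).trans f, fun i a => ?_⟩
  obtain ⟨k, rfl⟩ := e.surjective a
  -- compare the entries of the two codes in row `k` and column `i`
  have hk : (e.symm (r i (e k)) : ℕ) = f.symm (t i (f (finCongr hlen k))) := by
    have h1 := congrArg (fun L => L[(k : ℕ)]?) h
    have h2 : (k : ℕ) < (order t y).length := hlen ▸ k.2
    simp only [rootedCode, List.getElem?_map, List.getElem?_eq_getElem k.2,
      List.getElem?_eq_getElem h2, Option.map_some, Option.some.injEq] at h1
    have h3 := List.map_inj_left.1 h1 i (List.mem_finRange i)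
    exact h3
  change f (finCongr hlen (e.symm (r i (e k)))) = t i (f (finCongr hlen (e.symm (e k))))
  rw [e.symm_apply_apply]
  exact (f.eq_symm_apply).1 (Fin.ext hk)

end RootedCode

end ColouredGraph

/-! ### Involutions on six points -/

/-- Representatives of the conjugacy classes of involutions (and of the identity) on six points. -/
def involutionForms : List (Fin 6 → Fin 6) :=
  [id, ![1, 0, 2, 3, 4, 5], ![1, 0, 3, 2, 4, 5], ![1, 0, 3, 2, 5, 4]]

theorem exists_conj_mem_involutionForms (f : Equiv.Perm (Fin 6)) (hf : ∀ x, f (f x) = x) :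
    ∃ e : Equiv.Perm (Fin 6), (fun x => e (f (e.symm x))) ∈ involutionForms := by
  have key : ∀ g : Equiv.Perm (Fin 6), ⇑g ∈ involutionForms → f.cycleType = g.cycleType →
      ∃ e : Equiv.Perm (Fin 6), (fun x => e (f (e.symm x))) ∈ involutionForms := by
    intro g hg h
    obtain ⟨e, he⟩ := isConj_iff.1 (Equiv.Perm.isConj_iff_cycleType_eq.2 h)
    refine ⟨e, ?_⟩
    have : (fun x => e (f (e.symm x))) = g := by rw [← he]; rfl
    rwa [this]
  have h2 : f ^ 2 = 1 := Equiv.ext fun x => by simpa [sq] using hf x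
  -- the cycle type consists of at most three twos
  have hc := Equiv.Perm.cycleType_of_pow_prime_eq_one h2
  have hs : f.cycleType.sum ≤ 6 := by
    rw [Equiv.Perm.sum_cycleType]
    exact f.support.card_le_univ
  have hsw : ∀ i j : Fin 6, i ≠ j → (Equiv.swap i j).cycleType = {2} := fun i j hij =>
    Equiv.Perm.isSwap_iff_cycleType.1 ⟨i, j, hij, rfl⟩
  have h1 : (Equiv.swap 0 1 : Equiv.Perm (Fin 6)).cycleType = {2} :=
    hsw _ _ (by decide)
  have h2 : (Equiv.swap 0 1 * Equiv.swap 2 3 : Equiv.Perm (Fin 6)).cycleType = {2} + {2} := by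
    rw [Equiv.Perm.Disjoint.cycleType_mul (by unfold Equiv.Perm.Disjoint; decide), h1,
      hsw _ _ (by decide)]
  have h3 : (Equiv.swap 0 1 * Equiv.swap 2 3 * Equiv.swap 4 5 : Equiv.Perm (Fin 6)).cycleType =
      {2} + {2} + {2} := by
    rw [Equiv.Perm.Disjoint.cycleType_mul (by unfold Equiv.Perm.Disjoint; decide), h2,
      hsw _ _ (by decide)]
  rw [hc, Multiset.sum_replicate, smul_eq_mul] at hs
  have hn : f.cycleType.card ≤ 3 := by omega
  generalize f.cycleType.card = n at hc hn
  interval_cases n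
  · exact key 1 (by decide) (by rw [hc]; simp)
  · exact key (Equiv.swap 0 1) (by decide) (by rw [hc, h1]; rfl)
  · exact key (Equiv.swap 0 1 * Equiv.swap 2 3) (by decide) (by rw [hc, h2]; rfl)
  · exact key (Equiv.swap 0 1 * Equiv.swap 2 3 * Equiv.swap 4 5) (by decide)
      (by rw [hc, h3]; rfl)

/-- The list of the self-inverse functions on six points: the value at each point is chosen so
as to be compatible with the values at the points before it. -/
def involutions : List (Fin 6 → Fin 6) :=
  (List.finRange 6).flatMap fun a =>
  ((List.finRange 6).filter fun b => (a = 1 ↔ b = 0)).flatMap fun b =>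
  ((List.finRange 6).filter fun c => (a = 2 ↔ c = 0) ∧ (b = 2 ↔ c = 1)).flatMap fun c =>
  ((List.finRange 6).filter fun d => (a = 3 ↔ d = 0) ∧ (b = 3 ↔ d = 1) ∧
    (c = 3 ↔ d = 2)).flatMap fun d =>
  ((List.finRange 6).filter fun e => (a = 4 ↔ e = 0) ∧ (b = 4 ↔ e = 1) ∧ (c = 4 ↔ e = 2) ∧
    (d = 4 ↔ e = 3)).flatMap fun e =>
  ((List.finRange 6).filter fun f => (a = 5 ↔ f = 0) ∧ (b = 5 ↔ f = 1) ∧ (c = 5 ↔ f = 2) ∧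
    (d = 5 ↔ f = 3) ∧ (e = 5 ↔ f = 4)).map fun f => ![a, b, c, d, e, f]

theorem mem_involutions {f : Fin 6 → Fin 6} (hf : ∀ x, f (f x) = x) : f ∈ involutions := by
  have h : ∀ i j, f i = j ↔ f j = i := fun i j => ⟨fun h => h ▸ hf i, fun h => h ▸ hf j⟩
  simp only [involutions, List.mem_flatMap, List.mem_map, List.mem_filter, List.mem_finRange,
    true_and, decide_eq_true_eq]
  refine ⟨f 0, f 1, h _ _, f 2, ⟨h _ _, h _ _⟩, f 3, ⟨h _ _, h _ _, h _ _⟩,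
    f 4, ⟨h _ _, h _ _, h _ _, h _ _⟩, f 5, ⟨h _ _, h _ _, h _ _, h _ _, h _ _⟩, ?_⟩
  funext i
  fin_cases i <;> rfl

/-! ### The classification -/

namespace SymType

open ColouredGraph

/-- The neighbour functions of `6_{F_d}`. -/
def adjFd : Fin 3 → Fin 6 → Fin 6 :=
  ![![1, 0, 3, 2, 5, 4], ![0, 2, 1, 5, 4, 3], ![0, 1, 4, 5, 2, 3]]

/-- The neighbour functions of `6_{J_d}`. -/
def adjJd : Fin 3 → Fin 6 → Fin 6 :=
  ![![0, 1, 3, 2, 5, 4], ![0, 2, 1, 4, 3, 5], ![1, 0, 2, 3, 5, 4]]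

/-- The neighbour functions of `Tr(2_I)_p`, for `6_{B_p}`, `6_{G_p}`, `6_{H_p}`. -/
def adjTrP (I : Finset (Fin 3)) : Fin 3 → Fin 2 × Fin 3 → Fin 2 × Fin 3 :=
  petrieFun (truncAdj (two I))

/-- The neighbour functions of `(Tr(2_I)_d)_dp`, for `6_{M_dp}`, `6_{N_dp}`, `6_{O_dp}`,
`6_{P_dp}`. The two duals cancel; they are kept so that the graph agrees with `sixMdp` etc. by
definition. -/
def adjTrDP (I : Finset (Fin 3)) : Fin 3 → Fin 2 × Fin 3 → Fin 2 × Fin 3 :=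
  petrieFun (dualFun (dualFun (truncAdj (two I))))

/-- The neighbour functions of `(Tr(2_I)_d)_opp`, for `6_{M_opp}`, `6_{N_opp}`, `6_{O_opp}`,
`6_{P_opp}`. -/
def adjTrOpp (I : Finset (Fin 3)) : Fin 3 → Fin 2 × Fin 3 → Fin 2 × Fin 3 :=
  petrieFun (dualFun (petrieFun (dualFun (truncAdj (two I)))))

theorem ofFun_adjTrDP (I : Finset (Fin 3)) :
    ofFun (adjTrDP I) = (ofFun (truncAdj (two I))).dual.dual.petrie := by
  rw [dual_ofFun, dual_ofFun, petrie_ofFun, adjTrDP]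

theorem ofFun_adjTrOpp (I : Finset (Fin 3)) :
    ofFun (adjTrOpp I) = (ofFun (truncAdj (two I))).dual.opposite := by
  rw [opposite, dual_ofFun, petrie_ofFun, dual_ofFun, petrie_ofFun, adjTrOpp]

/-- The rooted codes of the types that the truncation may have. -/
def codes : List (List (List ℕ)) :=
  [rootedCode (adjTrP {0, 1}) (0, 0), rootedCode (adjTrP {0}) (0, 0),
    rootedCode (adjTrP {0, 2}) (0, 0), rootedCode adjJd 0, rootedCode (adjTrDP ∅) (0, 0),
    rootedCode adjFd 0, rootedCode (adjTrDP {2}) (0, 0), rootedCode (adjTrDP {1, 2}) (0, 0),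
    rootedCode (adjTrDP {1}) (0, 0)]

/-- The triples of involutions `r₀, r₁, r₂` on six points with `r₀r₂ = r₂r₀` and
`r₁r₂r₁ = r₂r₁r₂`, up to relabelling: `r₂` is in normal form. -/
def candidates : List (Fin 3 → Fin 6 → Fin 6) :=
  involutionForms.flatMap fun r2 =>
  (involutions.filter fun r0 => ∀ x, r0 (r2 x) = r2 (r0 x)).flatMap fun r0 =>
  (involutions.filter fun r1 => ∀ x, r1 (r2 (r1 x)) = r2 (r1 (r2 x))).map fun r1 =>
    ![r0, r1, r2]

set_option maxRecDepth 100000 in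
/-- The finite search: for every candidate, either the points found from `0` by means of
`untruncAdj r` form a proper closed subset, or the candidate is one of the nine graphs. -/
theorem candidates_all : (candidates.all fun r =>
    decide ((∃ z, z ∉ order (untruncAdj r) 0) ∧ ∀ v ∈ order (untruncAdj r) 0, ∀ i,
      untruncAdj r i v ∈ order (untruncAdj r) 0) ||
    decide (∃ x, rootedCode r x ∈ codes)) = true := by
  decide +kernel

/-- The symmetry type graphs on six vertices that can occur for the truncation of a map with six
flag-orbits. -/
def IsTruncationType {V : Type v} (r : Fin 3 → V → V) : Prop :=
  FunIso r (adjTrP {0, 1}) ∨ FunIso r (adjTrP {0}) ∨ FunIso r (adjTrP {0, 2}) ∨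
    FunIso r adjJd ∨ FunIso r (adjTrDP ∅) ∨ FunIso r adjFd ∨ FunIso r (adjTrDP {2}) ∨
    FunIso r (adjTrDP {1, 2}) ∨ FunIso r (adjTrDP {1})

theorem isTruncationType_of_rootedCode_mem {r : Fin 3 → Fin 6 → Fin 6} {x : Fin 6}
    (h : rootedCode r x ∈ codes) : IsTruncationType r := by
  simp only [codes, List.mem_cons, List.not_mem_nil, or_false] at h
  refine h.imp ?_ <| .imp ?_ <| .imp ?_ <| .imp ?_ <| .imp ?_ <| .imp ?_ <| .imp ?_ <| .imp ?_ ?_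
  all_goals exact fun h => funIso_of_rootedCode_eq (by decide) (by decide +kernel) h

/-- The classification for graphs on `Fin 6` that are labelled so that the edges of colour 2 are in
normal form. -/
theorem isTruncationType_fin {r : Fin 3 → Fin 6 → Fin 6} (hr : ∀ i x, r i (r i x) = x)
    (hcomm : ∀ x, r 0 (r 2 x) = r 2 (r 0 x))
    (hbraid : ∀ x, r 1 (r 2 (r 1 x)) = r 2 (r 1 (r 2 x)))
    (hconn : ∀ p : Fin 6 → Prop, (∀ i x, p x → p (untruncAdj r i x)) → ∀ x, p x → ∀ y, p y)
    (hform : r 2 ∈ involutionForms) : IsTruncationType r := by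
  have hmem : r ∈ candidates := by
    simp only [candidates, List.mem_flatMap, List.mem_map, List.mem_filter, decide_eq_true_eq]
    refine ⟨r 2, hform, r 0, ⟨mem_involutions (hr 0), hcomm⟩, r 1,
      ⟨mem_involutions (hr 1), hbraid⟩, ?_⟩
    funext i
    fin_cases i <;> rfl
  have h := List.all_eq_true.1 candidates_all r hmem
  simp only [Bool.or_eq_true, decide_eq_true_eq] at h
  obtain ⟨⟨z, hz⟩, hclosed⟩ | ⟨x, hx⟩ := h
  · exact absurd (hconn (· ∈ order (untruncAdj r) 0) (fun i x hx => hclosed x hx i) 0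
      (mem_order_self _ _) z) hz
  · exact isTruncationType_of_rootedCode_mem hx

/-- Classification of the symmetry type graphs on six vertices whose colours 1 and 2 satisfy the
braid relation and which remain connected under `untruncAdj`. -/
theorem isTruncationType_of_card {V : Type v} (hV : Nat.card V = 6) {r : Fin 3 → V → V}
    (hr : ∀ i x, r i (r i x) = x) (hcomm : ∀ x, r 0 (r 2 x) = r 2 (r 0 x))
    (hbraid : ∀ x, r 1 (r 2 (r 1 x)) = r 2 (r 1 (r 2 x)))
    (hconn : ∀ p : V → Prop, (∀ i x, p x → p (untruncAdj r i x)) → ∀ x, p x → ∀ y, p y) :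
    IsTruncationType r := by
  have := Nat.finite_of_card_ne_zero (hV.trans_ne (by decide))
  let e₀ : V ≃ Fin 6 := Finite.equivFinOfCardEq hV
  obtain ⟨f, hf⟩ := exists_conj_mem_involutionForms
    ((e₀.symm.trans (Function.Involutive.toPerm (r 2) (hr 2))).trans e₀)
    fun x => by
      change e₀ (r 2 (e₀.symm (e₀ (r 2 (e₀.symm x))))) = x
      simp [hr]
  -- label the vertices so that the edges of colour 2 are in normal form
  let e := e₀.trans f
  let t : Fin 3 → Fin 6 → Fin 6 := fun i x => e (r i (e.symm x))
  have hiso : ∀ i a, e (r i a) = t i (e a) := fun i a => by simp [t]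
  have hrt : FunIso r t := ⟨e, hiso⟩
  have ht : IsTruncationType t := by
    refine isTruncationType_fin (by simp [t, hr]) (by simp [t, hcomm]) (by simp [t, hbraid])
      (fun p hp x hx y => ?_) hf
    have := hconn (fun a => p (e a)) (fun i a ha => by
      rw [untruncAdj_comm hiso]; exact hp i _ ha) (e.symm x) (by simpa using hx) (e.symm y)
    simpa using this
  unfold IsTruncationType at ht ⊢
  exact ht.imp hrt.trans <| .imp hrt.trans <| .imp hrt.trans <| .imp hrt.trans <|
    .imp hrt.trans <| .imp hrt.trans <| .imp hrt.trans <| .imp hrt.trans hrt.trans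

/-- The neighbour functions of `6_{J_p}`. -/
def adjJp : Fin 3 → Fin 6 → Fin 6 := petrieFun (dualFun adjJd)

/-- The type of the map, for each of the nine types of its truncation. The cases are the truncations
of type `6_{B_p}`, `6_{G_p}`, `6_{H_p}`, `6_{J_d}`, `6_{N_dp}`, `6_{F_d}`, `6_{M_dp}`, `6_{P_dp}`,
`6_{O_dp}`. -/
theorem funIso_untruncAdj_six :
    FunIso (untruncAdj (adjTrP {0, 1})) (adjTrP {0, 1}) ∧
    FunIso (untruncAdj (adjTrP {0})) (adjTrP {0}) ∧
    FunIso (untruncAdj (adjTrP {0, 2})) (adjTrP {0, 2}) ∧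
    FunIso (untruncAdj adjJd) adjJp ∧
    FunIso (untruncAdj (adjTrDP ∅)) (adjTrOpp {2}) ∧
    FunIso (untruncAdj adjFd) (adjTrOpp ∅) ∧
    FunIso (untruncAdj (adjTrDP {2})) (adjTrOpp ∅) ∧
    FunIso (untruncAdj (adjTrDP {1, 2})) (adjTrOpp {1}) ∧
    FunIso (untruncAdj (adjTrDP {1})) (adjTrOpp {1, 2}) := by
  have key : ∀ {V W : Type} [DecidableEq V] [DecidableEq W] [Fintype V] [Fintype W]
      {r : Fin 3 → V → V} {t : Fin 3 → W → W} (y : W), Fintype.card V = Fintype.card W →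
      (order t y).length = Fintype.card W → (∃ x, rootedCode r x = rootedCode t y) →
      FunIso r t := fun y hc hy ⟨_, h⟩ => funIso_of_rootedCode_eq hc hy h
  refine ⟨key (0, 0) ?_ ?_ ?_, key (0, 0) ?_ ?_ ?_, key (0, 0) ?_ ?_ ?_, key 0 ?_ ?_ ?_,
    key (0, 0) ?_ ?_ ?_, key (0, 0) ?_ ?_ ?_, key (0, 0) ?_ ?_ ?_, key (0, 0) ?_ ?_ ?_,
    key (0, 0) ?_ ?_ ?_⟩
  all_goals decide +kernel

end SymType

open ColouredGraph SymType in
theorem mainTheorem5 (M : SurfaceMap.{u}) (hM : M.IsOrbitMap 6)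
    (hTr : M.truncation.IsOrbitMap 6) :
    (M.HasType SymType.sixBp ∧ M.truncation.HasType SymType.sixBp) ∨
    (M.HasType SymType.sixGp ∧ M.truncation.HasType SymType.sixGp) ∨
    (M.HasType SymType.sixHp ∧ M.truncation.HasType SymType.sixHp) ∨
    (M.HasType SymType.sixJp ∧ M.truncation.HasType SymType.sixJd) ∨
    (M.HasType SymType.sixMopp ∧ M.truncation.HasType SymType.sixNdp) ∨
    (M.HasType SymType.sixNopp ∧
      (M.truncation.HasType SymType.sixFd ∨ M.truncation.HasType SymType.sixMdp)) ∨
    (M.HasType SymType.sixOopp ∧ M.truncation.HasType SymType.sixPdp) ∨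
    (M.HasType SymType.sixPopp ∧ M.truncation.HasType SymType.sixOdp) := by
  obtain ⟨e, he⟩ := M.funIso_untruncAdj hM hTr
  -- connectedness of `T(M)`, carried over to the orbits of the truncation
  have hconn (p : M.truncation.Orb → Prop)
      (hp : ∀ i O, p O → p (untruncAdj M.truncation.orbAdj i O)) (O) (hO : p O) (P) : p P := by
    have := M.orb_induction (p := fun O => p (e O)) (fun i O h => he i O ▸ hp i _ h)
      (O := e.symm O) (by simpa using hO) (e.symm P)
    simpa using this
  have hQ := isTruncationType_of_card hTr.2 M.truncation.orbAdj_orbAdj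
    M.truncation.orbAdj_zero_two M.truncation_orbAdj_braid hconn
  have both {V W : Type} {t : Fin 3 → V → V} {s : Fin 3 → W → W} (hts : FunIso (untruncAdj t) s)
      (h : FunIso M.truncation.orbAdj t) :
      M.HasType (ofFun s) ∧ M.truncation.HasType (ofFun t) :=
    ⟨SurfaceMap.hasType_of_funIso ((FunIso.trans ⟨e, he⟩ h.untruncAdj).trans hts),
      SurfaceMap.hasType_of_funIso h⟩
  have hP (I) : ofFun (adjTrP I) = (ofFun (truncAdj (two I))).petrie := (petrie_ofFun _).symm
  have hJ : ofFun adjJp = sixJd.dual.petrie := by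
    rw [sixJd, dual_ofFun, petrie_ofFun]; rfl
  obtain ⟨iB, iG, iH, iJ, iM, iF, iN, iO, iP⟩ := funIso_untruncAdj_six
  obtain h | h | h | h | h | h | h | h | h := hQ
  · have := both iB h
    rw [hP] at this
    exact .inl this
  · have := both iG h
    rw [hP] at this
    exact .inr <| .inl this
  · have := both iH h
    rw [hP] at this
    exact .inr <| .inr <| .inl this
  · have := both iJ h
    rw [hJ] at this
    exact .inr <| .inr <| .inr <| .inl this
  · have := both iM h
    rw [ofFun_adjTrOpp, ofFun_adjTrDP] at this
    exact .inr <| .inr <| .inr <| .inr <| .inl this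
  · have := both iF h
    rw [ofFun_adjTrOpp] at this
    exact .inr <| .inr <| .inr <| .inr <| .inr <| .inl ⟨this.1, .inl this.2⟩
  · have := both iN h
    rw [ofFun_adjTrOpp, ofFun_adjTrDP] at this
    exact .inr <| .inr <| .inr <| .inr <| .inr <| .inl ⟨this.1, .inr this.2⟩
  · have := both iO h
    rw [ofFun_adjTrOpp, ofFun_adjTrDP] at this
    exact .inr <| .inr <| .inr <| .inr <| .inr <| .inr <| .inl this
  · have := both iP h
    rw [ofFun_adjTrOpp, ofFun_adjTrDP] at this
    exact .inr <| .inr <| .inr <| .inr <| .inr <| .inr <| .inr this
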